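/- For $z\in\mathbb C$ let $[z]=\lfloor \mathrm{Re}(z)+\tfrac12\rfloor+i\lfloor \mathrm{Im}(z)+\tfrac12\rfloor$ be the nearest Gaussian integer, and let $$\mathfrak F=\{z\in\mathbb C: -\tfrac12\le \mathrm{Re}(z)<\tfrac12,\ -\tfrac12\le \mathrm{Im}(z)<\tfrac12\}.$$ Let $T:\mathfrak F\to\mathfrak F$ be the complex Gauss map, $T(0)=0$ and $T(z)=z^{-1}-[z^{-1}]$ for $z\ne 0$. The Hurwitz continued fraction of $z\in\mathfrak F$ is the sequence of partial quotients $a_n(z)=[(T^{n-1}(z))^{-1}]$, $n\ge1$, defined as long as $T^{n-1}(z)\neq 0$; it is finite, $[a_1(z),\ldots,a_N(z)]_{\mathbb C}$, when $T^N(z)=0$ with $N$ minimal, and for a finite, non-empty one put $K_{\mathbb C}(z)=\max(|a_1(z)|,\ldots,|a_N(z)|)$. Theorem. Let $k\ge 1$ and let $m=(-2+i)^k$ or $m=(-2-i)^k$. Then there exists a Gaussian integer $a$ with $\gcd(a,m)=1$ and $a/m\in\mathfrak F$ such that the Hurwitz continued fraction of $a/m$ is finite and non-empty and $K_{\mathbb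 C}(a/m)\le 3\sqrt2$; that is, every partial quotient in the Hurwitz continued fraction of $a/m$ has modulus at most $3\sqrt2$. -/

import Mathlib

/-- The nearest Gaussian integer `[z] = ⌊Re z + 1/2⌋ + i ⌊Im z + 1/2⌋`. -/
noncomputable def nearestGaussianInt (z : ℂ) : GaussianInt :=
  ⟨⌊z.re + 1 / 2⌋, ⌊z.im + 1 / 2⌋⟩

/-- The half-open unit square `𝔉` centred at the origin. -/
def unitSquare : Set ℂ :=
  {z | -(1 / 2) ≤ z.re ∧ z.re < 1 / 2 ∧ -(1 / 2) ≤ z.im ∧ z.im < 1 / 2}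

theorem mem_unitSquare_iff (z : ℂ) : z ∈ unitSquare ↔ nearestGaussianInt z = 0 := by
  rw [nearestGaussianInt, Zsqrtd.ext_iff]
  simp only [Zsqrtd.re_zero, Zsqrtd.im_zero, Int.floor_eq_zero_iff, Set.mem_Ico, unitSquare,
    Set.mem_ofPred_eq]
  constructor
  · rintro ⟨h1, h2, h3, h4⟩
    refine ⟨⟨?_, ?_⟩, ?_, ?_⟩ <;> linarith
  · rintro ⟨⟨h1, h2⟩, h3, h4⟩
    refine ⟨?_, ?_, ?_, ?_⟩ <;> linarith

open Classical in
/-- The complex Gauss map `T(z) = z⁻¹ - [z⁻¹]` for `z ≠ 0`, and `T(0) = 0`. -/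
noncomputable def complexGaussMap (z : ℂ) : ℂ :=
  if z = 0 then 0 else z⁻¹ - (nearestGaussianInt z⁻¹ : ℂ)

/-- `[(Tⁿ z)⁻¹]`, which is the partial quotient `a_{n+1}(z)` of `z ∈ 𝔉` as long as `Tⁿ z ≠ 0`. -/
noncomputable def hurwitzQuotient (z : ℂ) (n : ℕ) : GaussianInt :=
  nearestGaussianInt (complexGaussMap^[n] z)⁻¹

/-- The Hurwitz continued fraction of `z ∈ 𝔉` is finite, and `w = [a₁(z), …, a_N(z)]` is the
complete list of its partial quotients: the orbit of `z` under the Gauss map reaches `0` for the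
first time after exactly `N` steps. -/
def IsHurwitzCF (z : ℂ) (w : List GaussianInt) : Prop :=
  z ∈ unitSquare ∧
  (∀ n < w.length, complexGaussMap^[n] z ≠ 0) ∧
  complexGaussMap^[w.length] z = 0 ∧
  w = (List.range w.length).map (hurwitzQuotient z)

/-! The proof folds continued fractions. If the word `w` has denominator Q, the corner entry of
`continuantMatrix w`, then `w`, x, `negReverse w` has denominator ±xQ² (`continuantMatrix_fold`).
Taking x to be the base of the power leads from exponent j to 2j + 1. Taking x = i would lead to 2j,
but i is too small a partial quotient; it is absorbed by the identity [..., l, i, y] = [..., l - i,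
y - i] (`continuantMatrix_fold_unit`). Explicit words for exponents 6 to 11 thus produce all larger
ones, and exponents below 6 get words of their own.

A formal word is a genuine Hurwitz expansion once the values of all its tails lie in the unit
square. The local condition `IsAdmissible` forces this (`IsAdmissible.isRegularWord_and_norm_le`)
and caps norms at 18 = (3√2)². Both folds preserve it when the end letters tolerate a shift by ±i.
-/

/-! ### Formal words, Hurwitz expansions and continuants -/

/-- The value of a formal continued fraction `[a₁, …, a_N]`. -/
noncomputable def cfValue : List GaussianInt → ℂ
  | [] => 0
  | a :: w => ((a : ℂ) + cfValue w)⁻¹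

/-- The product of the matrices `!![a, 1; 1, 0]`, whose entries are the continuants of the word. -/
def continuantMatrix : List GaussianInt → Matrix (Fin 2) (Fin 2) GaussianInt
  | [] => 1
  | a :: w => !![a, 1; 1, 0] * continuantMatrix w

/-- A word all of whose complete remainders lie in the unit square. -/
def IsRegularWord : List GaussianInt → Prop
  | [] => True
  | a :: w => IsRegularWord w ∧ (a : ℂ) + cfValue w ≠ 0 ∧ cfValue (a :: w) ∈ unitSquare

theorem nearestGaussianInt_add {t : ℂ} (ht : t ∈ unitSquare) (a : GaussianInt) :
    nearestGaussianInt ((a : ℂ) + t) = a := by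
  obtain ⟨h1, h2, h3, h4⟩ := ht
  rw [nearestGaussianInt, Zsqrtd.ext_iff]
  simp only [Int.floor_eq_iff, Complex.add_re, Complex.add_im, ← GaussianInt.intCast_re,
    ← GaussianInt.intCast_im]
  refine ⟨⟨?_, ?_⟩, ?_, ?_⟩ <;> linarith

theorem isHurwitzCF_nil : IsHurwitzCF 0 [] := by
  refine ⟨?_, by simp, by simp, by simp⟩
  simp [unitSquare]

theorem IsHurwitzCF.cons {t : ℂ} {w : List GaussianInt} (h : IsHurwitzCF t w) {a : GaussianInt}
    (h0 : (a : ℂ) + t ≠ 0) (hsq : ((a : ℂ) + t)⁻¹ ∈ unitSquare) :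
    IsHurwitzCF ((a : ℂ) + t)⁻¹ (a :: w) := by
  obtain ⟨ht, hne, hz, hw⟩ := h
  have hT : complexGaussMap ((a : ℂ) + t)⁻¹ = t := by
    rw [complexGaussMap, if_neg (inv_ne_zero h0), inv_inv, nearestGaussianInt_add ht]
    ring
  refine ⟨hsq, ?_, ?_, ?_⟩
  · rintro (_ | n) hn
    · simpa using h0
    · rw [Function.iterate_succ_apply, hT]
      exact hne n (by simpa using hn)
  · rw [List.length_cons, Function.iterate_succ_apply, hT, hz]
  · have hq : ∀ n, hurwitzQuotient ((a : ℂ) + t)⁻¹ (n + 1) = hurwitzQuotient t n := fun n => by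
      rw [hurwitzQuotient, Function.iterate_succ_apply, hT, hurwitzQuotient]
    have h1 : hurwitzQuotient ((a : ℂ) + t)⁻¹ 0 = a := by
      rw [hurwitzQuotient, Function.iterate_zero_apply, inv_inv, nearestGaussianInt_add ht]
    rw [List.length_cons, List.range_succ_eq_map, List.map_cons, List.map_map, h1]
    congr 1
    conv_lhs => rw [hw]
    exact List.map_congr_left fun n _ => (hq n).symm

theorem IsRegularWord.isHurwitzCF : ∀ {w : List GaussianInt}, IsRegularWord w →
    IsHurwitzCF (cfValue w) w
  | [], _ => isHurwitzCF_nil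
  | _ :: _, ⟨h, h0, hsq⟩ => h.isHurwitzCF.cons h0 hsq

theorem continuantMatrix_cons_zero (a : GaussianInt) (w : List GaussianInt) :
    continuantMatrix (a :: w) 0 0 = a * continuantMatrix w 0 0 + continuantMatrix w 1 0 := by
  simp [continuantMatrix, Matrix.mul_apply, Fin.sum_univ_two]

theorem continuantMatrix_cons_one (a : GaussianInt) (w : List GaussianInt) :
    continuantMatrix (a :: w) 1 0 = continuantMatrix w 0 0 := by
  simp [continuantMatrix, Matrix.mul_apply, Fin.sum_univ_two]

theorem continuantMatrix_append (v w : List GaussianInt) :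
    continuantMatrix (v ++ w) = continuantMatrix v * continuantMatrix w := by
  induction v with
  | nil => simp [continuantMatrix]
  | cons a v ih => simp [continuantMatrix, ih]

/-- The word `-a_N, …, -a₁`. -/
def negReverse (w : List GaussianInt) : List GaussianInt := (w.map Neg.neg).reverse

/-- With D = diag(1, -1), the matrix of the letter -a is -D·A·D, where A is the matrix of a. Each A
is symmetric, so reversing the word transposes the product. -/
theorem continuantMatrix_negReverse (w : List GaussianInt) :
    continuantMatrix (negReverse w) =
      (-1) ^ w.length • !![continuantMatrix w 0 0, -continuantMatrix w 1 0;
        -continuantMatrix w 0 1, continuantMatrix w 1 1] := by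
  induction w with
  | nil => ext i j : 1; fin_cases i <;> fin_cases j <;> simp [continuantMatrix, negReverse]
  | cons a w ih =>
    have : negReverse (a :: w) = negReverse w ++ [-a] := by simp [negReverse]
    rw [this, continuantMatrix_append, ih]
    ext i j : 1; fin_cases i <;> fin_cases j <;>
      simp [continuantMatrix, Matrix.mul_apply, Fin.sum_univ_two, pow_succ] <;> ring

theorem IsRegularWord.cfValue_eq : ∀ {w : List GaussianInt}, IsRegularWord w →
    continuantMatrix w 0 0 ≠ 0 ∧
      cfValue w = (continuantMatrix w 1 0 : ℂ) / (continuantMatrix w 0 0 : ℂ)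
  | [], _ => by simp [continuantMatrix, cfValue]
  | a :: w, ⟨h, h0, _⟩ => by
    obtain ⟨hQ, hv⟩ := h.cfValue_eq
    have hQ' : (continuantMatrix w 0 0 : ℂ) ≠ 0 := by
      rwa [Ne, GaussianInt.toComplex_eq_zero]
    -- Denominators are products of complete quotients, hence nonzero.
    have key : (continuantMatrix (a :: w) 0 0 : ℂ) =
        ((a : ℂ) + cfValue w) * (continuantMatrix w 0 0 : ℂ) := by
      rw [continuantMatrix_cons_zero, hv, map_add, map_mul]
      field_simp
    refine ⟨?_, ?_⟩
    · refine GaussianInt.toComplex_eq_zero.not.1 ?_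
      rw [key]
      exact mul_ne_zero h0 hQ'
    · rw [key, continuantMatrix_cons_one, cfValue]
      field_simp

theorem isCoprime_continuantMatrix (w : List GaussianInt) :
    IsCoprime (continuantMatrix w 1 0) (continuantMatrix w 0 0) := by
  induction w with
  | nil => simp [continuantMatrix, isCoprime_one_right]
  | cons a w ih =>
    rw [continuantMatrix_cons_zero, continuantMatrix_cons_one, add_comm]
    exact ih.symm.add_mul_right_right a

theorem norm_toComplex_sq (a : GaussianInt) : ‖(a : ℂ)‖ ^ 2 = (a.norm : ℝ) := by
  rw [GaussianInt.intCast_real_norm, Complex.normSq_eq_norm_sq]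

theorem IsRegularWord.exists_fraction {w : List GaussianInt} (hw : IsRegularWord w) (hne : w ≠ [])
    (hle : ∀ b ∈ w, b.norm ≤ 18) {m : GaussianInt}
    (hm : Associated (continuantMatrix w 0 0) m) :
    ∃ a : GaussianInt, IsCoprime a m ∧ (a : ℂ) / (m : ℂ) ∈ unitSquare ∧
      ∃ w : List GaussianInt, w ≠ [] ∧ IsHurwitzCF ((a : ℂ) / (m : ℂ)) w ∧
        ∀ b ∈ w, ‖(b : ℂ)‖ ≤ 3 * √2 := by
  obtain ⟨u, rfl⟩ := hm
  have hu : ((u : GaussianInt) : ℂ) ≠ 0 := by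
    rw [Ne, GaussianInt.toComplex_eq_zero]; exact u.ne_zero
  have hval : ((continuantMatrix w 1 0 * u : GaussianInt) : ℂ) /
      ((continuantMatrix w 0 0 * u : GaussianInt) : ℂ) = cfValue w := by
    rw [map_mul, map_mul, mul_div_mul_right _ _ hu, hw.cfValue_eq.2]
  refine ⟨continuantMatrix w 1 0 * u, ?_, ?_, w, hne, ?_, ?_⟩
  · rw [isCoprime_mul_unit_right u.isUnit]
    exact isCoprime_continuantMatrix w
  · rw [hval]; exact hw.isHurwitzCF.1
  · rw [hval]; exact hw.isHurwitzCF
  · intro b hb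
    refine abs_le_of_sq_le_sq' ?_ (by positivity) |>.2
    rw [norm_toComplex_sq, mul_pow, Real.sq_sqrt (by norm_num)]
    have : (b.norm : ℝ) ≤ 18 := by exact_mod_cast hle b hb
    linarith

/-! ### Admissible words and regularity -/

/-- Neighbours of a letter of norm `5` have norm at least `9`. -/
def Compatible (a b : GaussianInt) : Prop :=
  (a.norm = 5 → 9 ≤ b.norm) ∧ (b.norm = 5 → 9 ≤ a.norm)

instance : DecidableRel Compatible := fun _ _ => inferInstanceAs (Decidable (_ ∧ _))

/-- Words whose letters are large enough for regularity and small enough for the bound `3√2`. -/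
def IsAdmissible (w : List GaussianInt) : Prop :=
  (∀ a ∈ w, a.norm = 5 ∨ 8 ≤ a.norm ∧ a.norm ≤ 18) ∧ w.IsChain Compatible

instance : DecidablePred IsAdmissible := fun _ => inferInstanceAs (Decidable (_ ∧ _))

/-- Inversion carries the four lines bounding the square to the unit circles centred at ±1 and ±i.
-/
theorem inv_mem_unitSquare {z : ℂ} (h1 : 1 < ‖z - 1‖) (h2 : 1 < ‖z + 1‖)
    (h3 : 1 < ‖z - Complex.I‖) (h4 : 1 < ‖z + Complex.I‖) : z⁻¹ ∈ unitSquare := by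
  have sq : ∀ x : ℂ, 1 < ‖x‖ → 1 < x.re * x.re + x.im * x.im := fun x hx => by
    rw [← Complex.normSq_apply, Complex.normSq_eq_norm_sq]; nlinarith
  have g1 := sq _ h1
  have g2 := sq _ h2
  have g3 := sq _ h3
  have g4 := sq _ h4
  simp at g1 g2 g3 g4
  have hpos : 0 < Complex.normSq z := by
    rw [Complex.normSq_apply]; nlinarith
  have hn := Complex.normSq_apply z
  simp only [unitSquare, Set.mem_ofPred_eq, Complex.inv_re, Complex.inv_im]
  refine ⟨?_, ?_, ?_, ?_⟩
  · rw [le_div_iff₀ hpos]; nlinarith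
  · rw [div_lt_iff₀ hpos]; nlinarith
  · rw [le_div_iff₀ hpos]; nlinarith
  · rw [div_lt_iff₀ hpos]; nlinarith

theorem sqrt_two_le_norm_toComplex {a : GaussianInt} (h : 2 ≤ a.norm) : √2 ≤ ‖(a : ℂ)‖ := by
  refine Real.sqrt_le_iff.2 ⟨norm_nonneg _, ?_⟩
  rw [norm_toComplex_sq]
  exact_mod_cast h

/-- A Gaussian integer of norm 5 is at distance at least √2 from ±1 and ±i, so a perturbation below
√2 - 1 stays outside the four unit discs. -/
theorem inv_add_mem_unitSquare_of_norm_eq_five {a : GaussianInt} (ha : a.norm = 5) {t : ℂ}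
    (ht : ‖t‖ < √2 - 1) : ((a : ℂ) + t)⁻¹ ∈ unitSquare := by
  have hN : a.re * a.re + a.im * a.im = 5 := by
    rw [Zsqrtd.norm_def] at ha; linarith
  have key : ∀ b : GaussianInt, 2 ≤ (a + b).norm → 1 < ‖(a : ℂ) + t + b‖ := fun b hb => by
    have h1 := sqrt_two_le_norm_toComplex hb
    have h2 := norm_sub_le ((a : ℂ) + t + b) t
    have h3 : (a : ℂ) + t + b - t = ((a + b : GaussianInt) : ℂ) := by rw [map_add]; ring
    rw [h3] at h2
    linarith
  have k1 := key (-1) (by simp [Zsqrtd.norm_def]; nlinarith)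
  have k2 := key 1 (by simp [Zsqrtd.norm_def]; nlinarith)
  have k3 := key ⟨0, -1⟩ (by simp [Zsqrtd.norm_def]; nlinarith)
  have k4 := key ⟨0, 1⟩ (by simp [Zsqrtd.norm_def]; nlinarith)
  simp only [GaussianInt.toComplex_def, Zsqrtd.re_neg, Zsqrtd.im_neg, Zsqrtd.re_one,
    Zsqrtd.im_one, Int.cast_zero, Int.cast_one, Int.cast_neg, zero_add, neg_zero, zero_mul,
    add_zero, one_mul, neg_mul, zero_sub, ← sub_eq_add_neg] at k1 k2 k3 k4 ⊢
  exact inv_mem_unitSquare k1 k2 k3 k4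

theorem mem_unitSquare_of_norm_lt {t : ℂ} (ht : ‖t‖ < √2 - 1) : t ∈ unitSquare := by
  have h2 : √2 < 1.5 := by rw [Real.sqrt_lt' (by norm_num)]; norm_num
  have hr := abs_le.1 (Complex.abs_re_le_norm t)
  have hi := abs_le.1 (Complex.abs_im_le_norm t)
  refine ⟨?_, ?_, ?_, ?_⟩ <;> linarith

theorem norm_inv_lt_sqrt_two_sub_one {z : ℂ} (hz : √2 + 1 < ‖z‖) : ‖z⁻¹‖ < √2 - 1 := by
  have h2 : √2 * √2 = 2 := Real.mul_self_sqrt (by norm_num)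
  have h1 : 1 < √2 := by rw [Real.lt_sqrt (by norm_num)]; norm_num
  rw [norm_inv, inv_lt_iff_one_lt_mul₀ (by linarith)]
  nlinarith

/-- The induction carries two bounds: 11/20 always, and √2 - 1 unless the first letter has norm 5.
Compatibility ensures that a letter of norm 5 only meets a tail obeying the sharper bound. -/
theorem IsAdmissible.isRegularWord_and_norm_le (w : List GaussianInt) (hw : IsAdmissible w) :
    IsRegularWord w ∧ ‖cfValue w‖ ≤ 11 / 20 ∧
      ((∀ a ∈ w.head?, a.norm ≠ 5) → ‖cfValue w‖ < √2 - 1) := by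
  have hs : √2 * √2 = 2 := Real.mul_self_sqrt (by norm_num)
  have h1 : 1.414 < √2 := by rw [Real.lt_sqrt (by norm_num)]; norm_num
  have h2 : √2 < 1.415 := by rw [Real.sqrt_lt' (by norm_num)]; norm_num
  induction w with
  | nil =>
    simp only [IsRegularWord, cfValue, norm_zero, true_and]
    exact ⟨by norm_num, fun _ => by linarith⟩
  | cons a w ih =>
    obtain ⟨hl, hc⟩ := hw
    rw [List.isChain_cons] at hc
    obtain ⟨hreg, hle, hlt⟩ := ih ⟨fun b hb => hl b (List.mem_cons_of_mem _ hb), hc.2⟩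
    have htri := norm_sub_norm_le (a : ℂ) (-cfValue w)
    rw [sub_neg_eq_add, norm_neg] at htri
    have hsq := norm_toComplex_sq a
    rcases hl a List.mem_cons_self with ha | ⟨ha, -⟩
    · have ht : ‖cfValue w‖ < √2 - 1 := hlt fun b hb => by
        have := (hc.1 b hb).1 ha
        omega
      rw [ha] at hsq
      have ha' : 2.236 < ‖(a : ℂ)‖ := by
        push_cast at hsq
        nlinarith [norm_nonneg (a : ℂ)]
      -- √5 - (√2 - 1) ≈ 1.822 just exceeds 20/11 ≈ 1.818.
      have hpos : 20 / 11 < ‖(a : ℂ) + cfValue w‖ := by linarith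
      refine ⟨⟨hreg, ?_, inv_add_mem_unitSquare_of_norm_eq_five ha ht⟩, ?_, ?_⟩
      · exact norm_pos_iff.1 (by linarith)
      · rw [cfValue, norm_inv, inv_le_comm₀ (by linarith) (by norm_num)]
        linarith
      · intro h
        exact absurd ha (h a (by simp))
    · have hbig : √2 + 1 < ‖(a : ℂ) + cfValue w‖ := by
        by_cases hh : ∀ b ∈ w.head?, b.norm ≠ 5
        · have h8 : (8 : ℝ) ≤ ‖(a : ℂ)‖ ^ 2 := by rw [hsq]; exact_mod_cast ha
          -- The bound reproduces itself: 2√2 - (√2 - 1) = √2 + 1, the inverse of √2 - 1.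
          have : 2 * √2 ≤ ‖(a : ℂ)‖ := by
            refine abs_le_of_sq_le_sq' ?_ (norm_nonneg _) |>.2
            nlinarith
          linarith [hlt hh]
        · push Not at hh
          obtain ⟨b, hb, hb5⟩ := hh
          have h9 : (9 : ℝ) ≤ ‖(a : ℂ)‖ ^ 2 := by
            rw [hsq]; exact_mod_cast (hc.1 b hb).2 hb5
          -- Only 11/20 is available for the tail here, and 3 - 11/20 = 2.45 > √2 + 1.
          have : 3 ≤ ‖(a : ℂ)‖ := by nlinarith [norm_nonneg (a : ℂ)]
          linarith
      have hlt' := norm_inv_lt_sqrt_two_sub_one hbig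
      refine ⟨⟨hreg, norm_pos_iff.1 (by linarith), mem_unitSquare_of_norm_lt hlt'⟩, ?_,
        fun _ => hlt'⟩
      rw [cfValue]
      linarith

theorem IsAdmissible.exists_fraction {w : List GaussianInt} (hw : IsAdmissible w) (hne : w ≠ [])
    {m : GaussianInt} (hm : Associated (continuantMatrix w 0 0) m) :
    ∃ a : GaussianInt, IsCoprime a m ∧ (a : ℂ) / (m : ℂ) ∈ unitSquare ∧
      ∃ w : List GaussianInt, w ≠ [] ∧ IsHurwitzCF ((a : ℂ) / (m : ℂ)) w ∧
        ∀ b ∈ w, ‖(b : ℂ)‖ ≤ 3 * √2 :=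
  (IsAdmissible.isRegularWord_and_norm_le w hw).1.exists_fraction hne
    (fun b hb => by rcases hw.1 b hb with h | h <;> omega) hm

/-! ### Foldable words and the two folds -/

theorem compatible_of_le_left {a b : GaussianInt} (ha : 9 ≤ a.norm) : Compatible a b :=
  ⟨fun h => by omega, fun _ => ha⟩

theorem compatible_of_le_right {a b : GaussianInt} (hb : 9 ≤ b.norm) : Compatible a b :=
  ⟨fun _ => hb, fun h => by omega⟩

theorem IsAdmissible.negReverse {w : List GaussianInt} (hw : IsAdmissible w) :
    IsAdmissible (negReverse w) := by
  refine ⟨?_, ?_⟩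
  · intro a ha
    simp only [_root_.negReverse, List.mem_reverse, List.mem_map] at ha
    obtain ⟨b, hb, rfl⟩ := ha
    rw [Zsqrtd.norm_neg]
    exact hw.1 b hb
  · rw [_root_.negReverse, List.isChain_reverse, List.isChain_map]
    refine hw.2.imp fun a b h => ?_
    simp only [Compatible, Zsqrtd.norm_neg]
    exact h.symm

theorem IsAdmissible.append {v w : List GaussianInt} (hv : IsAdmissible v) (hw : IsAdmissible w)
    (h : ∀ a ∈ v.getLast?, ∀ b ∈ w.head?, Compatible a b) : IsAdmissible (v ++ w) :=
  ⟨fun a ha => (List.mem_append.1 ha).elim (hv.1 a) (hw.1 a),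
    List.isChain_append.2 ⟨hv.2, hw.2, h⟩⟩

/-- Letters that stay admissible when a unit `±i` is added. -/
def IsEndLetter (a : GaussianInt) : Prop :=
  (9 ≤ a.norm ∧ a.norm ≤ 18) ∧ (9 ≤ (a + ⟨0, 1⟩).norm ∧ (a + ⟨0, 1⟩).norm ≤ 18) ∧
    (9 ≤ (a - ⟨0, 1⟩).norm ∧ (a - ⟨0, 1⟩).norm ≤ 18)

instance : DecidablePred IsEndLetter := fun _ => inferInstanceAs (Decidable (_ ∧ _))

theorem IsEndLetter.neg {a : GaussianInt} (h : IsEndLetter a) : IsEndLetter (-a) := by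
  have e1 : -a + ⟨0, 1⟩ = -(a - ⟨0, 1⟩) := by ring
  have e2 : -a - ⟨0, 1⟩ = -(a + ⟨0, 1⟩) := by ring
  rw [IsEndLetter, e1, e2, Zsqrtd.norm_neg, Zsqrtd.norm_neg, Zsqrtd.norm_neg]
  exact ⟨h.1, h.2.2, h.2.1⟩

/-- There is an admissible word with foldable ends whose denominator is associated to `m`. -/
def IsFoldable (m : GaussianInt) : Prop :=
  ∃ (f : GaussianInt) (v : List GaussianInt) (l : GaussianInt), IsAdmissible (f :: v ++ [l]) ∧
    IsEndLetter f ∧ IsEndLetter l ∧ Associated (continuantMatrix (f :: v ++ [l]) 0 0) m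

theorem IsFoldable.exists_fraction {m : GaussianInt} (h : IsFoldable m) :
    ∃ a : GaussianInt, IsCoprime a m ∧ (a : ℂ) / (m : ℂ) ∈ unitSquare ∧
      ∃ w : List GaussianInt, w ≠ [] ∧ IsHurwitzCF ((a : ℂ) / (m : ℂ)) w ∧
        ∀ b ∈ w, ‖(b : ℂ)‖ ≤ 3 * √2 := by
  obtain ⟨f, v, l, hw, -, -, hm⟩ := h
  exact hw.exists_fraction (by simp) hm

/-- Up to sign, the product is (xQ + R)Q - QR, with R the entry to the right of Q; the cross terms
cancel. -/
theorem continuantMatrix_fold (w : List GaussianInt) (x : GaussianInt) :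
    continuantMatrix (w ++ x :: negReverse w) 0 0 =
      (-1) ^ w.length * (x * continuantMatrix w 0 0 ^ 2) := by
  rw [continuantMatrix_append, continuantMatrix, continuantMatrix_negReverse]
  simp [Matrix.mul_apply, Fin.sum_univ_two]
  ring

theorem continuantMatrix_fold_unit (w : List GaussianInt) (l : GaussianInt) :
    continuantMatrix (w ++ (l - ⟨0, 1⟩) :: (-l - ⟨0, 1⟩) :: negReverse w) 0 0 =
      (-1) ^ (w.length + 1) * continuantMatrix (w ++ [l]) 0 0 ^ 2 := by
  have hi : (⟨0, 1⟩ : GaussianInt) ^ 2 = -1 := by decide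
  rw [continuantMatrix_append, continuantMatrix, continuantMatrix, continuantMatrix_negReverse,
    continuantMatrix_append]
  generalize (⟨0, 1⟩ : GaussianInt) = i at hi
  simp [continuantMatrix, Matrix.mul_apply, Fin.sum_univ_two, pow_succ]
  linear_combination (-1) ^ w.length * continuantMatrix w 0 0 ^ 2 * hi

theorem associated_neg_one_pow_mul (n : ℕ) (a : GaussianInt) : Associated ((-1) ^ n * a) a :=
  associated_unit_mul_left a _ (isUnit_one.neg.pow n)

/-- The letter x of norm 5 lands between l and -l, both of norm at least 9. The new ends are f and
-f, which is why f must be an end letter too. -/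
theorem IsFoldable.mul_sq {m : GaussianInt} (h : IsFoldable m) {x : GaussianInt}
    (hx : x.norm = 5) : IsFoldable (x * m ^ 2) := by
  obtain ⟨f, v, l, hw, hf, hl, hm⟩ := h
  have e : f :: (v ++ [l] ++ x :: negReverse (v ++ [l])) ++ [-f] =
      (f :: v ++ [l]) ++ x :: negReverse (f :: v ++ [l]) := by
    simp [negReverse]
  have hd : negReverse (f :: v ++ [l]) = -l :: negReverse (f :: v) := by simp [negReverse]
  refine ⟨f, v ++ [l] ++ x :: negReverse (v ++ [l]), -f, ?_, hf, hf.neg, ?_⟩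
  · rw [e]
    have hx' : IsAdmissible [x] := ⟨by simp [hx], by simp⟩
    refine hw.append (w := [x] ++ negReverse (f :: v ++ [l])) (hx'.append hw.negReverse ?_) ?_
    · rw [hd]
      simp only [List.head?_cons, Option.mem_def, Option.some.injEq]
      rintro _ _ _ rfl
      exact compatible_of_le_right hl.neg.1.1
    · simp only [List.getLast?_append, List.getLast?_singleton, Option.mem_def]
      rintro a ha
      simp at ha
      subst ha
      exact fun _ _ => compatible_of_le_left hl.1.1
  · rw [e, continuantMatrix_fold]
    exact (associated_neg_one_pow_mul _ _).trans (hm.pow_pow.mul_left x)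

/-- The two middle letters are l - i and -(l + i), which the end condition on l keeps between norms
9 and 18. -/
theorem IsFoldable.sq {m : GaussianInt} (h : IsFoldable m) : IsFoldable (m ^ 2) := by
  obtain ⟨f, v, l, hw, hf, hl, hm⟩ := h
  have e : f :: (v ++ (l - ⟨0, 1⟩) :: (-l - ⟨0, 1⟩) :: negReverse v) ++ [-f] =
      (f :: v) ++ (l - ⟨0, 1⟩) :: (-l - ⟨0, 1⟩) :: negReverse (f :: v) := by
    simp [negReverse]
  have hv : IsAdmissible (f :: v) :=
    ⟨fun a ha => hw.1 a (List.mem_append_left _ ha), (List.isChain_append.1 hw.2).1⟩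
  have hp : 9 ≤ (-l - ⟨0, 1⟩ : GaussianInt).norm := hl.neg.2.2.1
  refine ⟨f, v ++ (l - ⟨0, 1⟩) :: (-l - ⟨0, 1⟩) :: negReverse v, -f, ?_, hf, hf.neg, ?_⟩
  · rw [e]
    have hmid : IsAdmissible [l - ⟨0, 1⟩, -l - ⟨0, 1⟩] := ?_
    · refine hv.append (w := [l - ⟨0, 1⟩, -l - ⟨0, 1⟩] ++ negReverse (f :: v))
        (hmid.append hv.negReverse ?_) ?_
      · intro a ha b _
        simp only [List.getLast?_cons_cons, List.getLast?_singleton, Option.mem_def,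
          Option.some.injEq] at ha
        subst ha
        exact compatible_of_le_left hp
      · intro a _ b hb
        simp only [List.cons_append, List.head?_cons, Option.mem_def, Option.some.injEq] at hb
        subst hb
        exact compatible_of_le_right hl.2.2.1
    refine ⟨?_, ?_⟩
    · intro a ha
      simp only [List.mem_cons, List.not_mem_nil, or_false] at ha
      rcases ha with rfl | rfl
      · exact Or.inr ⟨by linarith [hl.2.2.1], hl.2.2.2⟩
      · exact Or.inr ⟨by linarith, hl.neg.2.2.2⟩
    · simpa using compatible_of_le_right hp
  · rw [e, continuantMatrix_fold_unit]
    exact (associated_neg_one_pow_mul _ _).trans hm.pow_pow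

theorem associated_of_mul_eq {a b u : GaussianInt} (hu : u.norm = 1) (h : a * u = b) :
    Associated a b := by
  have : IsUnit u := by
    rw [← Zsqrtd.norm_eq_one_iff, hu]; rfl
  exact ⟨this.unit, h⟩

/-- Exponent k is reached from ⌊k/2⌋, which is at least 6 as soon as k ≥ 12. -/
theorem IsFoldable.pow_of_seeds {x : GaussianInt} (hx : x.norm = 5)
    (hseed : ∀ k, 6 ≤ k → k < 12 → IsFoldable (x ^ k)) (k : ℕ) (hk : 6 ≤ k) :
    IsFoldable (x ^ k) := by
  induction k using Nat.strong_induction_on with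
  | _ k ih =>
    by_cases h : k < 12
    · exact hseed k hk h
    · have h' := ih (k / 2) (by omega) (by omega)
      rcases Nat.even_or_odd' k with ⟨j, rfl | rfl⟩
      · rw [Nat.mul_div_cancel_left j two_pos] at h'
        rw [mul_comm, pow_mul]
        exact h'.sq
      · rw [show (2 * j + 1) / 2 = j by omega] at h'
        rw [pow_succ', mul_comm 2 j, pow_mul]
        exact h'.mul_sq hx

theorem isFoldable_of_mul_eq {m : GaussianInt} (f : GaussianInt) (v : List GaussianInt)
    (l u : GaussianInt)
    (h : IsAdmissible (f :: v ++ [l]) ∧ IsEndLetter f ∧ IsEndLetter l ∧ u.norm = 1 ∧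
      continuantMatrix (f :: v ++ [l]) 0 0 * u = m) : IsFoldable m :=
  ⟨f, v, l, h.1, h.2.1, h.2.2.1, associated_of_mul_eq h.2.2.2.1 h.2.2.2.2⟩

theorem exists_fraction_of_mul_eq {m : GaussianInt} (w : List GaussianInt) (u : GaussianInt)
    (h : IsAdmissible w ∧ w ≠ [] ∧ u.norm = 1 ∧ continuantMatrix w 0 0 * u = m) :
    ∃ a : GaussianInt, IsCoprime a m ∧ (a : ℂ) / (m : ℂ) ∈ unitSquare ∧
      ∃ w : List GaussianInt, w ≠ [] ∧ IsHurwitzCF ((a : ℂ) / (m : ℂ)) w ∧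
        ∀ b ∈ w, ‖(b : ℂ)‖ ≤ 3 * √2 :=
  h.1.exists_fraction h.2.1 (associated_of_mul_eq h.2.2.1 h.2.2.2)

/-! ### Explicit words for small exponents -/

/-- Serves exponent 2, where the denominator is 3 + 4ei. The letter 2 has norm 4, so the word is not
admissible and regularity is checked by hand. -/
theorem isRegularWord_two_one_add_two_mul_I {e : ℤ} (he : e ^ 2 = 1) :
    IsRegularWord [⟨2, 0⟩, ⟨1, 2 * e⟩] := by
  have he' : (e : ℝ) ^ 2 = 1 := by exact_mod_cast he
  have hlast : IsAdmissible [⟨1, 2 * e⟩] := by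
    refine ⟨?_, by simp⟩
    simp only [List.mem_singleton, forall_eq, Zsqrtd.norm_def]
    exact Or.inl (by linarith)
  have hN : Complex.normSq ((⟨1, 2 * e⟩ : GaussianInt) : ℂ) = 5 := by
    simp [GaussianInt.toComplex_def, Complex.normSq_apply]
    linarith
  have hv : cfValue [(⟨1, 2 * e⟩ : GaussianInt)] = ⟨1 / 5, -(2 * e / 5)⟩ := by
    rw [cfValue, cfValue, add_zero, Complex.inv_def, hN]
    apply Complex.ext <;> simp [GaussianInt.toComplex_def] <;> ring
  have hsum : ((⟨2, 0⟩ : GaussianInt) : ℂ) + cfValue [(⟨1, 2 * e⟩ : GaussianInt)] =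
      ⟨11 / 5, -(2 * e / 5)⟩ := by
    rw [hv]
    apply Complex.ext <;> simp [GaussianInt.toComplex_def]
    norm_num
  have hN' : Complex.normSq ⟨11 / 5, -(2 * e / 5)⟩ = 5 := by
    simp only [Complex.normSq_mk]
    linarith
  have hb : (e : ℝ) ≤ 1 ∧ -1 ≤ (e : ℝ) := by constructor <;> nlinarith
  refine ⟨(IsAdmissible.isRegularWord_and_norm_le _ hlast).1, ?_, ?_⟩
  · rw [hsum, ← Complex.normSq_pos, hN']
    norm_num
  · rw [cfValue, hsum]
    simp only [unitSquare, Set.mem_ofPred_eq, Complex.inv_re, Complex.inv_im, hN']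
    refine ⟨?_, ?_, ?_, ?_⟩ <;> linarith

theorem isFoldable_pow_neg_two_add_I (k : ℕ) (hk : 6 ≤ k) :
    IsFoldable ((⟨-2, 1⟩ : GaussianInt) ^ k) := by
  refine IsFoldable.pow_of_seeds (by decide) (fun j h1 h2 => ?_) k hk
  interval_cases j
  · exact isFoldable_of_mul_eq ⟨3, 1⟩ [⟨-3, 2⟩, ⟨3, -3⟩] ⟨-3, 0⟩ ⟨0, -1⟩ (by decide +kernel)
  · exact isFoldable_of_mul_eq ⟨3, 1⟩ [⟨3, 0⟩, ⟨2, -2⟩, ⟨1, -3⟩] ⟨-3, 0⟩ ⟨0, -1⟩ (by decide +kernel)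
  · exact isFoldable_of_mul_eq ⟨-4, 0⟩ [⟨1, 4⟩, ⟨3, 0⟩, ⟨-4, 0⟩] ⟨-3, 1⟩ ⟨0, -1⟩ (by decide +kernel)
  · exact isFoldable_of_mul_eq ⟨-3, -1⟩ [⟨3, 2⟩, ⟨-4, 0⟩, ⟨1, 3⟩, ⟨-3, 1⟩] ⟨4, 0⟩ ⟨1, 0⟩ (by decide +kernel)
  · exact isFoldable_of_mul_eq ⟨-3, -1⟩ [⟨3, -2⟩, ⟨3, 2⟩, ⟨-2, 2⟩, ⟨3, 0⟩, ⟨-3, 1⟩] ⟨-3, 2⟩ ⟨-1, 0⟩ (by decide +kernel)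
  · exact isFoldable_of_mul_eq ⟨-4, 0⟩ [⟨-1, -4⟩, ⟨-1, 3⟩, ⟨3, -1⟩, ⟨2, -3⟩, ⟨-3, 1⟩] ⟨-3, 1⟩ ⟨-1, 0⟩ (by decide +kernel)

theorem isFoldable_pow_neg_two_sub_I (k : ℕ) (hk : 6 ≤ k) :
    IsFoldable ((⟨-2, -1⟩ : GaussianInt) ^ k) := by
  refine IsFoldable.pow_of_seeds (by decide) (fun j h1 h2 => ?_) k hk
  interval_cases j
  · exact isFoldable_of_mul_eq ⟨3, -1⟩ [⟨-3, -2⟩, ⟨3, 3⟩] ⟨-3, 0⟩ ⟨0, 1⟩ (by decide +kernel)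
  · exact isFoldable_of_mul_eq ⟨3, -1⟩ [⟨3, 0⟩, ⟨2, 2⟩, ⟨1, 3⟩] ⟨-3, 0⟩ ⟨0, 1⟩ (by decide +kernel)
  · exact isFoldable_of_mul_eq ⟨-4, 0⟩ [⟨1, -4⟩, ⟨3, 0⟩, ⟨-4, 0⟩] ⟨-3, -1⟩ ⟨0, 1⟩ (by decide +kernel)
  · exact isFoldable_of_mul_eq ⟨-3, 1⟩ [⟨3, -2⟩, ⟨-4, 0⟩, ⟨1, -3⟩, ⟨-3, -1⟩] ⟨4, 0⟩ ⟨1, 0⟩ (by decide +kernel)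
  · exact isFoldable_of_mul_eq ⟨-3, 1⟩ [⟨3, 2⟩, ⟨3, -2⟩, ⟨-2, -2⟩, ⟨3, 0⟩, ⟨-3, -1⟩] ⟨-3, -2⟩ ⟨-1, 0⟩ (by decide +kernel)
  · exact isFoldable_of_mul_eq ⟨-4, 0⟩ [⟨-1, 4⟩, ⟨-1, -3⟩, ⟨3, 1⟩, ⟨2, 3⟩, ⟨-3, -1⟩] ⟨-3, -1⟩ ⟨-1, 0⟩ (by decide +kernel)

theorem mainTheorem4 (k : ℕ) (hk : 1 ≤ k) (m : GaussianInt)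
    (hm : m = (⟨-2, 1⟩ : GaussianInt) ^ k ∨ m = (⟨-2, -1⟩ : GaussianInt) ^ k) :
    ∃ a : GaussianInt, IsCoprime a m ∧ (a : ℂ) / (m : ℂ) ∈ unitSquare ∧
      ∃ w : List GaussianInt, w ≠ [] ∧ IsHurwitzCF ((a : ℂ) / (m : ℂ)) w ∧
        ∀ b ∈ w, ‖(b : ℂ)‖ ≤ 3 * √2 := by
  rcases Nat.lt_or_ge k 6 with h6 | h6
  · rcases hm with rfl | rfl <;> interval_cases k
    · exact exists_fraction_of_mul_eq [⟨-1, -2⟩] ⟨0, -1⟩ (by decide +kernel)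
    · exact (isRegularWord_two_one_add_two_mul_I (e := -1) rfl).exists_fraction (by simp) (by decide +kernel)
        (associated_of_mul_eq (u := 1) (by decide +kernel) (by decide +kernel))
    · exact exists_fraction_of_mul_eq [⟨-1, -3⟩, ⟨-3, -2⟩] ⟨1, 0⟩ (by decide +kernel)
    · exact exists_fraction_of_mul_eq [⟨-3, -1⟩, ⟨4, -1⟩, ⟨-1, -2⟩] ⟨-1, 0⟩ (by decide +kernel)
    · exact exists_fraction_of_mul_eq [⟨-1, 4⟩, ⟨-3, 3⟩, ⟨-3, 1⟩] ⟨1, 0⟩ (by decide +kernel)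
    · exact exists_fraction_of_mul_eq [⟨-1, 2⟩] ⟨0, 1⟩ (by decide +kernel)
    · exact (isRegularWord_two_one_add_two_mul_I (e := 1) rfl).exists_fraction (by simp) (by decide +kernel)
        (associated_of_mul_eq (u := 1) (by decide +kernel) (by decide +kernel))
    · exact exists_fraction_of_mul_eq [⟨-1, 3⟩, ⟨-3, 2⟩] ⟨1, 0⟩ (by decide +kernel)
    · exact exists_fraction_of_mul_eq [⟨-3, 1⟩, ⟨4, 1⟩, ⟨-1, 2⟩] ⟨-1, 0⟩ (by decide +kernel)
    · exact exists_fraction_of_mul_eq [⟨-1, -4⟩, ⟨-3, -3⟩, ⟨-3, -1⟩] ⟨1, 0⟩ (by decide +kernel)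
  · rcases hm with rfl | rfl
    · exact (isFoldable_pow_neg_two_add_I k h6).exists_fraction
    · exact (isFoldable_pow_neg_two_sub_I k h6).exists_fraction
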